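/- Let $q$ be a complex number with $|q|<1$. Write $(a;q)_n=\prod_{j=0}^{n-1}(1-aq^{j})$, $(a;q)_\infty=\prod_{j=0}^{\infty}(1-aq^{j})$, $(a_1,\dots,a_r;q)_\infty=(a_1;q)_\infty\cdots(a_r;q)_\infty$, $(q)_n=(q;q)_n$, $(q)_\infty=(q;q)_\infty$, and $${N\brack k}=\frac{(q)_N}{(q)_k\,(q)_{N-k}}\qquad(0\le k\le N).$$ Then the series over $n$ below (whose terms are finite sums over integers $m$) converges absolutely, and $$\sum_{n=0}^{\infty}\ \sum_{m=-\lfloor (n+1)/2\rfloor}^{\lfloor n/2\rfloor}\frac{(-1)^m\,q^{\,n(n+2)+m(5m+3)/2}}{(1+q^{n+1})\,(q)_{2n+1}}{2n+1\brack n-2m}=\frac{(q,q^{12},q^{13};q^{13})_\infty}{(q)_\infty}.$$ -/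

import Mathlib

/-- The finite `q`-shifted factorial `(a; q)_n = ∏_{j = 0}^{n - 1} (1 - a q ^ j)`. -/
noncomputable def qPochhammer (a q : ℂ) (n : ℕ) : ℂ :=
  ∏ j ∈ Finset.range n, (1 - a * q ^ j)

/-- The infinite `q`-shifted factorial `(a; q)_∞ = ∏_{j = 0}^∞ (1 - a q ^ j)`, for `‖q‖ < 1`. -/
noncomputable def qPochhammerInf (a q : ℂ) : ℂ :=
  ∏' j : ℕ, (1 - a * q ^ j)

/-- The product that defines `(a; q)_∞` converges (unconditionally) when `‖q‖ < 1`. -/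
theorem multipliable_qPochhammerInf (a : ℂ) {q : ℂ} (hq : ‖q‖ < 1) :
    Multipliable fun j : ℕ => 1 - a * q ^ j := by
  have h : Summable fun j : ℕ => ‖-(a * q ^ j)‖ := by
    simpa [norm_mul, norm_pow] using
      (summable_geometric_of_lt_one (norm_nonneg q) hq).mul_left ‖a‖
  simpa [sub_eq_add_neg] using multipliable_one_add_of_summable h

/-- The `q`-binomial coefficient `(q; q)_N / ((q; q)_k (q; q)_{N - k})`, with the usual convention
that it vanishes unless `0 ≤ k ≤ N`. -/
noncomputable def qBinomial (q : ℂ) (N : ℕ) (k : ℤ) : ℂ :=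
  if 0 ≤ k ∧ k ≤ (N : ℤ) then
    qPochhammer q q N / (qPochhammer q q k.toNat * qPochhammer q q (N - k.toNat))
  else 0

open Filter Topology

/-! Pair the indices `m = k` and `m = -(k + 1)`. Over the common denominator `(q)_{n-2k}
(q)_{n+2k+2}` the numerators combine to `(1 - q^(n+2k+2)) - q^(2k+1) (1 - q^(n-2k)) = (1 - q^(2k+1))
(1 + q^(n+1))`, so the factor `1 + q^(n+1)` cancels (`innerTerm_add_innerTerm`). The double series
over `(n, k)` converges absolutely. Summed over `n = j + 2k` first, it is Cauchy's series with `t =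
4k + 2`, equal to `1/(q)_∞` (`hasSum_durfeeTerm`). The remaining series in `k` is Jacobi's triple
product in base `q^13` with `a = q^12`, `b = q`; it follows from Euler's expansion and Cauchy's
identity. -/

theorem qPochhammer_zero (a q : ℂ) : qPochhammer a q 0 = 1 := by simp [qPochhammer]

theorem qPochhammer_succ (a q : ℂ) (n : ℕ) :
    qPochhammer a q (n + 1) = qPochhammer a q n * (1 - a * q ^ n) := by
  simp [qPochhammer, Finset.prod_range_succ]

theorem qPochhammer_self_succ (q : ℂ) (n : ℕ) :
    qPochhammer q q (n + 1) = qPochhammer q q n * (1 - q ^ (n + 1)) := by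
  rw [qPochhammer_succ, pow_succ']

theorem one_sub_pow_succ_ne_zero {q : ℂ} (hq : ‖q‖ < 1) (n : ℕ) : 1 - q ^ (n + 1) ≠ 0 := by
  intro h
  have h1 : ‖q ^ (n + 1)‖ < 1 := by
    rw [norm_pow]; exact pow_lt_one₀ (norm_nonneg q) hq n.succ_ne_zero
  rw [← sub_eq_zero.mp h] at h1
  simp at h1

theorem one_add_pow_succ_ne_zero {q : ℂ} (hq : ‖q‖ < 1) (n : ℕ) : 1 + q ^ (n + 1) ≠ 0 := by
  intro h
  have h1 : ‖q ^ (n + 1)‖ < 1 := by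
    rw [norm_pow]; exact pow_lt_one₀ (norm_nonneg q) hq n.succ_ne_zero
  rw [eq_neg_of_add_eq_zero_right h] at h1
  simp at h1

theorem qPochhammer_self_ne_zero {q : ℂ} (hq : ‖q‖ < 1) (n : ℕ) : qPochhammer q q n ≠ 0 := by
  induction n with
  | zero => simp [qPochhammer_zero]
  | succ n ih =>
    rw [qPochhammer_self_succ]
    exact mul_ne_zero ih (one_sub_pow_succ_ne_zero hq n)

theorem tendsto_qPochhammer (a : ℂ) {q : ℂ} (hq : ‖q‖ < 1) :
    Tendsto (qPochhammer a q) atTop (𝓝 (qPochhammerInf a q)) :=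
  (multipliable_qPochhammerInf a hq).hasProd.tendsto_prod_nat

theorem qPochhammerInf_self_ne_zero {q : ℂ} (hq : ‖q‖ < 1) : qPochhammerInf q q ≠ 0 := by
  have h : Summable fun j : ℕ => ‖-(q * q ^ j)‖ := by
    simpa [norm_mul, norm_pow] using
      (summable_geometric_of_lt_one (norm_nonneg q) hq).mul_left ‖q‖
  have := tprod_one_add_ne_zero_of_summable (f := fun j : ℕ => -(q * q ^ j)) (fun j => by
    rw [← sub_eq_add_neg, ← pow_succ']; exact one_sub_pow_succ_ne_zero hq j) h
  simpa [qPochhammerInf, sub_eq_add_neg] using this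

theorem tendsto_inv_qPochhammer_self {q : ℂ} (hq : ‖q‖ < 1) :
    Tendsto (fun n => (qPochhammer q q n)⁻¹) atTop (𝓝 (qPochhammerInf q q)⁻¹) :=
  (tendsto_qPochhammer q hq).inv₀ (qPochhammerInf_self_ne_zero hq)

theorem exists_bound_inv_qPochhammer_self {q : ℂ} (hq : ‖q‖ < 1) :
    ∃ C : ℝ, 0 ≤ C ∧ ∀ n, ‖(qPochhammer q q n)⁻¹‖ ≤ C := by
  obtain ⟨C, hC⟩ := (tendsto_inv_qPochhammer_self hq).norm.bddAbove_range
  have hC' : ∀ n, ‖(qPochhammer q q n)⁻¹‖ ≤ C := fun n => hC ⟨n, rfl⟩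
  exact ⟨C, (norm_nonneg _).trans (hC' 0), hC'⟩

/-! ### Cauchy's identity. -/

/-- The term `q ^ (n ^ 2 + n t) / ((q)_n (q)_{n + t})` of the sum over Durfee rectangles. -/
noncomputable def durfeeTerm (q : ℂ) (t n : ℕ) : ℂ :=
  q ^ (n ^ 2 + n * t) * ((qPochhammer q q n)⁻¹ * (qPochhammer q q (n + t))⁻¹)

theorem norm_pow_le_norm_pow {q : ℂ} (hq : ‖q‖ < 1) {m n : ℕ} (h : m ≤ n) :
    ‖q ^ n‖ ≤ ‖q‖ ^ m := by
  rw [norm_pow]; exact pow_le_pow_of_le_one (norm_nonneg q) hq.le h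

theorem norm_one_sub_pow_le {q : ℂ} (hq : ‖q‖ < 1) (n : ℕ) : ‖1 - q ^ n‖ ≤ 2 := by
  calc ‖1 - q ^ n‖ ≤ ‖(1 : ℂ)‖ + ‖q ^ n‖ := norm_sub_le _ _
    _ ≤ 1 + 1 := by
      gcongr
      · simp
      · simpa using norm_pow_le_norm_pow hq (Nat.zero_le n)
    _ = 2 := by norm_num

theorem exists_bound_durfeeTerm {q : ℂ} (hq : ‖q‖ < 1) :
    ∃ C : ℝ, 0 ≤ C ∧ ∀ t n, ‖durfeeTerm q t n‖ ≤ C * ‖q‖ ^ n := by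
  obtain ⟨C, hC0, hC⟩ := exists_bound_inv_qPochhammer_self hq
  refine ⟨C * C, mul_nonneg hC0 hC0, fun t n => ?_⟩
  rw [durfeeTerm, norm_mul, norm_mul, mul_comm]
  gcongr
  · exact hC _
  · exact hC _
  · exact norm_pow_le_norm_pow hq (by nlinarith)

theorem summable_durfeeTerm {q : ℂ} (hq : ‖q‖ < 1) (t : ℕ) : Summable (durfeeTerm q t) := by
  obtain ⟨C, -, hC⟩ := exists_bound_durfeeTerm hq
  exact .of_norm_bounded ((summable_geometric_of_lt_one (norm_nonneg q) hq).mul_left C) (hC t)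

/-- As `t → ∞` only the term `n = 0` survives. -/
theorem tendsto_tsum_durfeeTerm {q : ℂ} (hq : ‖q‖ < 1) :
    Tendsto (fun t => ∑' n, durfeeTerm q t n) atTop (𝓝 (qPochhammerInf q q)⁻¹) := by
  obtain ⟨C, -, hC⟩ := exists_bound_durfeeTerm hq
  have key := tendsto_tsum_of_dominated_convergence (𝓕 := atTop)
    (f := fun t n => durfeeTerm q t n)
    (g := fun n : ℕ => if n = 0 then (qPochhammerInf q q)⁻¹ else 0)
    ((summable_geometric_of_lt_one (norm_nonneg q) hq).mul_left C) (fun n => ?_)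
    (.of_forall fun t n => hC t n)
  · simpa using key
  rcases Nat.eq_zero_or_pos n with rfl | hn
  · simpa [durfeeTerm, qPochhammer_zero] using tendsto_inv_qPochhammer_self hq
  · have h1 : Tendsto (fun t => q ^ (n ^ 2 + n * t)) atTop (𝓝 0) := by
      refine (tendsto_pow_atTop_nhds_zero_of_norm_lt_one hq).comp
        (tendsto_atTop_mono (fun t => ?_) tendsto_id)
      simp only [id]; nlinarith
    have h2 : Tendsto (fun t => (qPochhammer q q (n + t))⁻¹) atTop
        (𝓝 (qPochhammerInf q q)⁻¹) :=
      (tendsto_inv_qPochhammer_self hq).comp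
        (tendsto_atTop_mono (fun t => Nat.le_add_left t n) tendsto_id)
    simpa [durfeeTerm, hn.ne'] using h1.mul (h2.const_mul (qPochhammer q q n)⁻¹)

theorem durfeeTerm_telescope {q : ℂ} (hq : ‖q‖ < 1) (t n : ℕ) :
    durfeeTerm q t n - durfeeTerm q (t + 1) n +
        q ^ (t + 1) * (durfeeTerm q (t + 1) n - durfeeTerm q (t + 2) n) =
      q ^ (n ^ 2 + n * t) * (1 - q ^ n) *
          ((qPochhammer q q n)⁻¹ * (qPochhammer q q (n + (t + 1)))⁻¹) -
        q ^ ((n + 1) ^ 2 + (n + 1) * t) * (1 - q ^ (n + 1)) *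
          ((qPochhammer q q (n + 1))⁻¹ * (qPochhammer q q (n + 1 + (t + 1)))⁻¹) := by
  have e1 : n + (t + 1) = n + t + 1 := by ring
  have e2 : n + (t + 2) = n + t + 1 + 1 := by ring
  have e3 : n + 1 + (t + 1) = n + t + 1 + 1 := by ring
  have h0 := qPochhammer_self_ne_zero hq n
  have h1 := qPochhammer_self_ne_zero hq (n + t)
  have h2 := one_sub_pow_succ_ne_zero hq n
  have h3 := one_sub_pow_succ_ne_zero hq (n + t)
  have h4 := one_sub_pow_succ_ne_zero hq (n + t + 1)
  simp only [durfeeTerm, e1, e2, e3]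
  rw [qPochhammer_self_succ q (n + t + 1), qPochhammer_self_succ q (n + t),
    qPochhammer_self_succ q n]
  generalize qPochhammer q q n = A at *
  generalize qPochhammer q q (n + t) = B at *
  field_simp
  ring

theorem tsum_durfeeTerm_sub {q : ℂ} (hq : ‖q‖ < 1) (t : ℕ) :
    (∑' n, durfeeTerm q t n) - ∑' n, durfeeTerm q (t + 1) n =
      -q ^ (t + 1) * ((∑' n, durfeeTerm q (t + 1) n) - ∑' n, durfeeTerm q (t + 2) n) := by
  set h : ℕ → ℂ := fun n => q ^ (n ^ 2 + n * t) * (1 - q ^ n) *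
    ((qPochhammer q q n)⁻¹ * (qPochhammer q q (n + (t + 1)))⁻¹) with hh
  have hs : Summable h := by
    obtain ⟨C, hC0, hC⟩ := exists_bound_inv_qPochhammer_self hq
    refine .of_norm_bounded
      ((summable_geometric_of_lt_one (norm_nonneg q) hq).mul_right (2 * (C * C))) fun n => ?_
    rw [hh]
    simp only [norm_mul, mul_assoc]
    have := norm_one_sub_pow_le hq n
    gcongr
    · exact norm_pow_le_norm_pow hq (by nlinarith)
    · exact hC _
    · exact hC _
  have s0 := summable_durfeeTerm hq t
  have s1 := summable_durfeeTerm hq (t + 1)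
  have s2 := summable_durfeeTerm hq (t + 2)
  have h1 := hs.tsum_eq_zero_add
  -- The telescoping sum equals `h 0`, which vanishes through the factor `1 - q ^ 0`.
  have h2 : ∑' n, (h n - h (n + 1)) = 0 := by
    rw [hs.tsum_sub ((summable_nat_add_iff 1).mpr hs), h1]
    simp [hh]
  rw [tsum_congr fun n => (durfeeTerm_telescope hq t n).symm,
    (s0.sub s1).tsum_add ((s1.sub s2).mul_left _), tsum_mul_left, s0.tsum_sub s1,
    s1.tsum_sub s2] at h2
  linear_combination h2

/-- Consecutive differences satisfy `D t = -q^(t+1) D (t+1)`, so `‖D t‖` is nondecreasing in `t`; it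
also tends to `0`, hence vanishes identically. -/
theorem tsum_durfeeTerm_succ {q : ℂ} (hq : ‖q‖ < 1) (t : ℕ) :
    ∑' n, durfeeTerm q (t + 1) n = ∑' n, durfeeTerm q t n := by
  set D : ℕ → ℂ := fun t => (∑' n, durfeeTerm q t n) - ∑' n, durfeeTerm q (t + 1) n with hD
  have hle : ∀ t, ‖D t‖ ≤ ‖D (t + 1)‖ := fun t => by
    have : D t = -q ^ (t + 1) * D (t + 1) := tsum_durfeeTerm_sub hq t
    rw [this, norm_mul, norm_neg]
    refine mul_le_of_le_one_left (norm_nonneg _) ?_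
    simpa using norm_pow_le_norm_pow hq (Nat.zero_le (t + 1))
  have hlim : Tendsto (fun t => ‖D t‖) atTop (𝓝 0) := by
    have h := tendsto_tsum_durfeeTerm hq
    simpa using (h.sub (h.comp (tendsto_add_atTop_nat 1))).norm
  have := (monotone_nat_of_le_succ hle).ge_of_tendsto hlim t
  exact (sub_eq_zero.mp (norm_le_zero_iff.mp this)).symm

/-- Cauchy's identity `∑ q ^ (n ^ 2 + n t) / ((q)_n (q)_{n + t}) = 1 / (q)_∞`. -/
theorem hasSum_durfeeTerm {q : ℂ} (hq : ‖q‖ < 1) (t : ℕ) :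
    HasSum (durfeeTerm q t) (qPochhammerInf q q)⁻¹ := by
  have hc : ∀ t, ∑' n, durfeeTerm q t n = ∑' n, durfeeTerm q 0 n := fun t => by
    induction t with
    | zero => rfl
    | succ t ih => rw [tsum_durfeeTerm_succ hq, ih]
  have h := tendsto_tsum_durfeeTerm hq
  simp only [hc] at h
  rw [← tendsto_nhds_unique tendsto_const_nhds h, ← hc t]
  exact (summable_durfeeTerm hq t).hasSum

theorem two_mul_choose_two_add (n : ℕ) : 2 * n.choose 2 + n = n ^ 2 := by
  induction n with
  | zero => rfl
  | succ n ih =>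
    rw [Nat.choose_succ_succ' n 1, Nat.choose_one_right]
    linear_combination ih

theorem add_choose_two (m n : ℕ) : (m + n).choose 2 = m.choose 2 + n.choose 2 + m * n := by
  have h1 := two_mul_choose_two_add (m + n)
  have h2 := two_mul_choose_two_add m
  have h3 := two_mul_choose_two_add n
  nlinarith

/-! ### Euler's expansion. -/

/-- The `n`-th term of Euler's expansion of `(a; q)_∞`. -/
noncomputable def eulerTerm (a q : ℂ) (n : ℕ) : ℂ :=
  (-1) ^ n * q ^ n.choose 2 * (qPochhammer q q n)⁻¹ * a ^ n

theorem exists_bound_eulerTerm {q : ℂ} (hq : ‖q‖ < 1) :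
    ∃ C : ℝ, 0 ≤ C ∧ ∀ a n, ‖eulerTerm a q n‖ ≤ C * ‖a‖ ^ n := by
  obtain ⟨C, hC0, hC⟩ := exists_bound_inv_qPochhammer_self hq
  refine ⟨C, hC0, fun a n => ?_⟩
  rw [eulerTerm, norm_mul, norm_mul, norm_mul, norm_pow a]
  gcongr
  calc _ ≤ 1 * 1 * C := by
        gcongr
        · simp
        · simpa using norm_pow_le_norm_pow hq (Nat.zero_le (n.choose 2))
        · exact hC n
    _ = C := by ring

theorem summable_eulerTerm {a q : ℂ} (hq : ‖q‖ < 1) (ha : ‖a‖ < 1) :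
    Summable fun n => ‖eulerTerm a q n‖ := by
  obtain ⟨C, -, hC⟩ := exists_bound_eulerTerm hq
  exact .of_nonneg_of_le (fun _ => norm_nonneg _) (hC a)
    ((summable_geometric_of_lt_one (norm_nonneg a) ha).mul_left C)

theorem norm_mul_pow_le {q : ℂ} (hq : ‖q‖ < 1) (a : ℂ) (n : ℕ) : ‖a * q ^ n‖ ≤ ‖a‖ := by
  rw [norm_mul]
  exact mul_le_of_le_one_right (norm_nonneg a) (by simpa using norm_pow_le_norm_pow hq n.zero_le)

/-- Functional equation `F(a) = (1 - a) F(aq)`, read off coefficientwise; iterating it drives the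
argument to `0`, where `F = 1`. -/
theorem tsum_eulerTerm_eq {a q : ℂ} (hq : ‖q‖ < 1) (ha : ‖a‖ < 1) :
    ∑' n, eulerTerm a q n = (1 - a) * ∑' n, eulerTerm (a * q) q n := by
  have haq : ‖a * q‖ < 1 := by simpa using (norm_mul_pow_le hq a 1).trans_lt ha
  have s := (summable_eulerTerm hq ha).of_norm
  have s' := (summable_eulerTerm hq haq).of_norm
  have hstep : ∀ n, eulerTerm a q (n + 1) =
      eulerTerm (a * q) q (n + 1) - a * eulerTerm (a * q) q n := fun n => by
    have h0 := qPochhammer_self_ne_zero hq n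
    have h1 := one_sub_pow_succ_ne_zero hq n
    simp only [eulerTerm, Nat.choose_succ_succ' n 1, Nat.choose_one_right,
      qPochhammer_self_succ]
    field_simp
    ring
  have h0 : eulerTerm a q 0 = eulerTerm (a * q) q 0 := by simp [eulerTerm]
  rw [s.tsum_eq_zero_add, tsum_congr hstep,
    ((summable_nat_add_iff 1).mpr s').tsum_sub (s'.mul_left a), tsum_mul_left, h0]
  linear_combination -s'.tsum_eq_zero_add

theorem tsum_eulerTerm_eq_qPochhammer_mul {a q : ℂ} (hq : ‖q‖ < 1) (ha : ‖a‖ < 1) (n : ℕ) :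
    ∑' i, eulerTerm a q i = qPochhammer a q n * ∑' i, eulerTerm (a * q ^ n) q i := by
  induction n with
  | zero => simp [qPochhammer_zero]
  | succ n ih =>
    rw [ih, tsum_eulerTerm_eq hq ((norm_mul_pow_le hq a n).trans_lt ha), qPochhammer_succ,
      pow_succ]
    simp only [mul_assoc]

/-- Euler's expansion `(a; q)_∞ = ∑ (-a) ^ n q ^ (n (n - 1) / 2) / (q)_n`. -/
theorem hasSum_eulerTerm {a q : ℂ} (hq : ‖q‖ < 1) (ha : ‖a‖ < 1) :
    HasSum (eulerTerm a q) (qPochhammerInf a q) := by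
  obtain ⟨C, hC0, hC⟩ := exists_bound_eulerTerm hq
  have key := tendsto_tsum_of_dominated_convergence (𝓕 := atTop)
    (f := fun n i => eulerTerm (a * q ^ n) q i) (g := fun i : ℕ => if i = 0 then 1 else 0)
    ((summable_geometric_of_lt_one (norm_nonneg a) ha).mul_left C) (fun i => ?_)
    (.of_forall fun n i => (hC (a * q ^ n) i).trans (by gcongr; exact norm_mul_pow_le hq a n))
  · have h := (tendsto_qPochhammer a hq).mul key
    simp only [← tsum_eulerTerm_eq_qPochhammer_mul hq ha, tsum_ite_eq, mul_one] at h
    rw [tendsto_nhds_unique h tendsto_const_nhds]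
    exact (summable_eulerTerm hq ha).of_norm.hasSum
  · rcases Nat.eq_zero_or_pos i with rfl | hi
    · simp [eulerTerm, qPochhammer_zero]
    · have h := (((tendsto_pow_atTop_nhds_zero_of_norm_lt_one hq).const_mul a).pow i).const_mul
        ((-1) ^ i * q ^ i.choose 2 * (qPochhammer q q i)⁻¹)
      simpa [eulerTerm, hi.ne'] using h

/-! ### Jacobi's triple product. -/

/-- Pairs of naturals split according to the sign of the difference of the entries. -/
def natProdEquivSum : ℕ × ℕ ≃ (ℕ × ℕ) ⊕ (ℕ × ℕ) where
  toFun x := if x.2 ≤ x.1 then .inl (x.1 - x.2, x.2) else .inr (x.2 - x.1 - 1, x.1)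
  invFun := Sum.elim (fun y => (y.1 + y.2, y.2)) fun y => (y.2, y.1 + 1 + y.2)
  left_inv x := by
    by_cases h : x.2 ≤ x.1
    · simp [h]
    · simp only [h, if_false, Sum.elim_inr]
      ext <;> simp
      omega
  right_inv y := by
    rcases y with ⟨k, j⟩ | ⟨k, j⟩
    · simp
    · have h : ¬ k + 1 + j ≤ j := by omega
      simp only [Sum.elim_inr, h, if_false]
      congr 2
      omega

/-- Along a fixed index difference `k`, the product of two Euler series becomes Cauchy's series with
`t = k`. -/
theorem eulerTerm_mul_eulerTerm {a b q : ℂ} (hab : a * b = q) (k j : ℕ) :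
    eulerTerm a q (k + j) * eulerTerm b q j =
      (-1) ^ k * a ^ k * q ^ k.choose 2 * durfeeTerm q k j := by
  have h1 : (-1 : ℂ) ^ (k + j) * (-1) ^ j = (-1) ^ k := by
    rw [pow_add, mul_assoc, ← mul_pow]; simp
  have h2 : a ^ (k + j) * b ^ j = a ^ k * q ^ j := by rw [← hab]; ring
  have h3 : q ^ (k + j).choose 2 * q ^ j.choose 2 * q ^ j =
      q ^ k.choose 2 * q ^ (j ^ 2 + j * k) := by
    simp only [← pow_add, add_choose_two, ← two_mul_choose_two_add j]
    congr 1
    ring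
  rw [durfeeTerm, ← h1, add_comm j k]
  simp only [eulerTerm]
  linear_combination (-1 : ℂ) ^ (k + j) * (-1) ^ j * (qPochhammer q q (k + j))⁻¹ *
    (qPochhammer q q j)⁻¹ * (q ^ (k + j).choose 2 * q ^ j.choose 2 * h2 + a ^ k * h3)

/-- **Jacobi's triple product identity**, for parameters with `a b = q`. -/
theorem hasSum_jacobi_triple_product {a b q : ℂ} (hq : ‖q‖ < 1) (ha : ‖a‖ < 1) (hb : ‖b‖ < 1)
    (hab : a * b = q) :
    HasSum (fun k : ℕ => (-1) ^ k * a ^ k * q ^ k.choose 2 +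
        (-1) ^ (k + 1) * b ^ (k + 1) * q ^ (k + 1).choose 2)
      (qPochhammerInf a q * qPochhammerInf b q * qPochhammerInf q q) := by
  have hs := summable_mul_of_summable_norm (summable_eulerTerm hq ha) (summable_eulerTerm hq hb)
  have h := (hasSum_eulerTerm hq ha).mul (hasSum_eulerTerm hq hb) hs
  have hs' := natProdEquivSum.symm.summable_iff.mpr hs
  have h' := natProdEquivSum.symm.hasSum_iff.mpr h
  have s1 := (hs'.comp_injective Sum.inl_injective).hasSum
  have s2 := (hs'.comp_injective Sum.inr_injective).hasSum
  have h3 := s1.add s2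
  rw [(s1.sum s2).unique h'] at h3
  -- Each `k` collects the differences `k` and `-(k + 1)`; Cauchy's identity sums both diagonals.
  have h4 := (h3.prod_fiberwise (g := fun k => ((-1) ^ k * a ^ k * q ^ k.choose 2 +
    (-1) ^ (k + 1) * b ^ (k + 1) * q ^ (k + 1).choose 2) * (qPochhammerInf q q)⁻¹)
    fun k => ?_).mul_right (qPochhammerInf q q)
  · simpa [qPochhammerInf_self_ne_zero hq, mul_assoc] using h4
  · have d1 := (hasSum_durfeeTerm hq k).mul_left ((-1) ^ k * a ^ k * q ^ k.choose 2)
    have d2 := (hasSum_durfeeTerm hq (k + 1)).mul_left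
      ((-1) ^ (k + 1) * b ^ (k + 1) * q ^ (k + 1).choose 2)
    rw [add_mul]
    refine (d1.add d2).congr_fun fun j => ?_
    simp only [Function.comp_apply, natProdEquivSum, Equiv.coe_fn_symm_mk, Sum.elim_inl,
      Sum.elim_inr]
    rw [eulerTerm_mul_eulerTerm hab, mul_comm (eulerTerm a q j),
      eulerTerm_mul_eulerTerm ((mul_comm b a).trans hab)]

/-! ### Pairing the terms of the inner sum. -/

theorem qBinomial_natCast (q : ℂ) {N k : ℕ} (hk : k ≤ N) :
    qBinomial q N k = qPochhammer q q N / (qPochhammer q q k * qPochhammer q q (N - k)) := by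
  simp [qBinomial, hk]

theorem sum_Icc_neg_eq_sum_range (f : ℤ → ℂ) (K : ℕ) :
    ∑ m ∈ Finset.Icc (-(K : ℤ)) (K - 1), f m =
      ∑ k ∈ Finset.range K, (f k + f (-((k : ℤ) + 1))) := by
  induction K with
  | zero => simp
  | succ K ih =>
    have h : Finset.Icc (-((K + 1 : ℕ) : ℤ)) ((K + 1 : ℕ) - 1) =
        insert (K : ℤ) (insert (-((K : ℤ) + 1)) (Finset.Icc (-(K : ℤ)) (K - 1))) := by
      ext m
      simp only [Finset.mem_Icc, Finset.mem_insert]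
      push_cast
      omega
    rw [h, Finset.sum_insert, Finset.sum_insert, ih, Finset.sum_range_succ]
    · ring
    · simp only [Finset.mem_Icc]; omega
    · simp only [Finset.mem_Icc, Finset.mem_insert]; omega

/-- The summand of the inner sum. -/
noncomputable def innerTerm (q : ℂ) (n : ℕ) (m : ℤ) : ℂ :=
  (-1 : ℂ) ^ m * q ^ ((n : ℤ) * ((n : ℤ) + 2) + m * (5 * m + 3) / 2) /
      ((1 + q ^ (n + 1)) * qPochhammer q q (2 * n + 1)) *
    qBinomial q (2 * n + 1) ((n : ℤ) - 2 * m)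

/-- The contribution of the indices `k` and `-(k + 1)` to the inner sum. -/
noncomputable def pairTerm (q : ℂ) (n k : ℕ) : ℂ :=
  if 2 * k ≤ n then
    (-1) ^ k * q ^ ((k + 1).choose 2 + (2 * k ^ 2 + k) + (n ^ 2 + 2 * n)) * (1 - q ^ (2 * k + 1)) *
      ((qPochhammer q q (n - 2 * k))⁻¹ * (qPochhammer q q (n + 2 * k + 2))⁻¹)
  else 0

theorem innerTerm_natCast {q : ℂ} (hq : ‖q‖ < 1) {n k : ℕ} (h : 2 * k ≤ n) :
    innerTerm q n k =
      (-1) ^ k * q ^ ((k + 1).choose 2 + (2 * k ^ 2 + k) + (n ^ 2 + 2 * n)) *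
        ((1 + q ^ (n + 1))⁻¹ *
          ((qPochhammer q q (n - 2 * k))⁻¹ * (qPochhammer q q (n + 2 * k + 1))⁻¹)) := by
  have h2 : ((k + 1).choose 2 : ℤ) * 2 = k * (k + 1) := by
    have := two_mul_choose_two_add (k + 1)
    zify at this
    linear_combination this
  have hexp : (n : ℤ) * ((n : ℤ) + 2) + (k : ℤ) * (5 * k + 3) / 2 =
      (((k + 1).choose 2 + (2 * k ^ 2 + k) + (n ^ 2 + 2 * n) : ℕ) : ℤ) := by
    rw [Int.ediv_eq_of_eq_mul_left (b := 2) two_ne_zero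
      (c := (k + 1).choose 2 + (2 * k ^ 2 + k)) (by linear_combination -h2)]
    push_cast
    ring
  have hidx : (n : ℤ) - 2 * k = ((n - 2 * k : ℕ) : ℤ) := by omega
  have h0 := qPochhammer_self_ne_zero hq (2 * n + 1)
  rw [innerTerm, hexp, hidx, zpow_natCast, zpow_natCast, qBinomial_natCast q (by omega),
    show 2 * n + 1 - (n - 2 * k) = n + 2 * k + 1 by omega]
  field_simp

theorem innerTerm_neg_succ {q : ℂ} (hq : ‖q‖ < 1) {n k : ℕ} (h : 2 * k + 1 ≤ n) :
    innerTerm q n (-((k : ℤ) + 1)) =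
      -((-1) ^ k * q ^ ((k + 1).choose 2 + (2 * k ^ 2 + k) + (n ^ 2 + 2 * n)) * q ^ (2 * k + 1) *
        ((1 + q ^ (n + 1))⁻¹ *
          ((qPochhammer q q (n - 2 * k - 1))⁻¹ * (qPochhammer q q (n + 2 * k + 2))⁻¹))) := by
  have h2 : ((k + 1).choose 2 : ℤ) * 2 = k * (k + 1) := by
    have := two_mul_choose_two_add (k + 1)
    zify at this
    linear_combination this
  have hexp : (n : ℤ) * ((n : ℤ) + 2) + (-((k : ℤ) + 1)) * (5 * (-((k : ℤ) + 1)) + 3) / 2 =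
      (((k + 1).choose 2 + (2 * k ^ 2 + k) + (n ^ 2 + 2 * n) + (2 * k + 1) : ℕ) : ℤ) := by
    rw [Int.ediv_eq_of_eq_mul_left (b := 2) two_ne_zero
      (c := (k + 1).choose 2 + (2 * k ^ 2 + k) + (2 * k + 1)) (by linear_combination -h2)]
    push_cast
    ring
  have hidx : (n : ℤ) - 2 * (-((k : ℤ) + 1)) = ((n + 2 * k + 2 : ℕ) : ℤ) := by push_cast; ring
  have hsign : (-1 : ℂ) ^ (-((k : ℤ) + 1)) = -(-1) ^ k := by
    rw [zpow_neg, ← inv_zpow, show ((-1 : ℂ))⁻¹ = -1 by norm_num]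
    rw [show (k : ℤ) + 1 = ((k + 1 : ℕ) : ℤ) by push_cast; ring, zpow_natCast, pow_succ]
    ring
  have h0 := qPochhammer_self_ne_zero hq (2 * n + 1)
  rw [innerTerm, hexp, hidx, hsign, zpow_natCast, qBinomial_natCast q (by omega),
    show 2 * n + 1 - (n + 2 * k + 2) = n - 2 * k - 1 by omega, pow_add q _ (2 * k + 1)]
  field_simp

theorem innerTerm_neg_succ_eq_zero (q : ℂ) {n k : ℕ} (h : n ≤ 2 * k) :
    innerTerm q n (-((k : ℤ) + 1)) = 0 := by
  rw [innerTerm, qBinomial, if_neg (by push_cast; omega), mul_zero]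

theorem innerTerm_add_innerTerm {q : ℂ} (hq : ‖q‖ < 1) {n k : ℕ} (h : 2 * k ≤ n) :
    innerTerm q n k + innerTerm q n (-((k : ℤ) + 1)) = pairTerm q n k := by
  have h1 := one_add_pow_succ_ne_zero hq n
  rw [innerTerm_natCast hq h, pairTerm, if_pos h]
  obtain ⟨d, rfl⟩ := Nat.exists_eq_add_of_le h
  have e1 : 2 * k + d - 2 * k = d := by omega
  have e2 : qPochhammer q q (2 * k + d + 2 * k + 2) = _ :=
    qPochhammer_self_succ q (2 * k + d + 2 * k + 1)
  have n2 := qPochhammer_self_ne_zero hq (2 * k + d + 2 * k + 1)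
  have n3 := one_sub_pow_succ_ne_zero hq (2 * k + d + 2 * k + 1)
  rw [e1]
  -- For `n = 2k` the partner `-(k + 1)` lies outside the range of the `q`-binomial and contributes
  -- `0`.
  rcases d with _ | d
  · rw [innerTerm_neg_succ_eq_zero q (by omega), e2, qPochhammer_zero]
    generalize qPochhammer q q (2 * k + 0 + 2 * k + 1) = B at *
    generalize (-1) ^ k * q ^ ((k + 1).choose 2 + (2 * k ^ 2 + k) +
      ((2 * k + 0) ^ 2 + 2 * (2 * k + 0))) = W
    field_simp
    ring
  · rw [innerTerm_neg_succ hq (by omega), e2,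
      show 2 * k + (d + 1) - 2 * k - 1 = d by omega, qPochhammer_self_succ q d]
    have n4 := qPochhammer_self_ne_zero hq d
    have n5 := one_sub_pow_succ_ne_zero hq d
    generalize qPochhammer q q (2 * k + (d + 1) + 2 * k + 1) = B at *
    generalize qPochhammer q q d = A at *
    generalize (-1) ^ k * q ^ ((k + 1).choose 2 + (2 * k ^ 2 + k) +
      ((2 * k + (d + 1)) ^ 2 + 2 * (2 * k + (d + 1)))) = W
    field_simp
    ring

theorem sum_innerTerm {q : ℂ} (hq : ‖q‖ < 1) (n : ℕ) :
    ∑ m ∈ Finset.Icc (-(((n : ℤ) + 1) / 2)) ((n : ℤ) / 2), innerTerm q n m =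
      ∑ k ∈ Finset.range (n / 2 + 1), pairTerm q n k := by
  have h := sum_Icc_neg_eq_sum_range (innerTerm q n) (n / 2 + 1)
  rw [Finset.sum_congr rfl fun k hk => innerTerm_add_innerTerm hq (n := n) (k := k)
    (by rw [Finset.mem_range] at hk; omega)] at h
  rw [← h]
  -- For even `n` the pairing adds one index, `m = -(n/2 + 1)`, whose term is zero.
  refine Finset.sum_subset (Finset.Icc_subset_Icc (by push_cast; omega) (by push_cast; omega))
    fun m hm hm' => ?_
  rw [Finset.mem_Icc] at hm hm'
  have : m = -(((n / 2 : ℕ) : ℤ) + 1) := by push_cast at hm ⊢; omega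
  rw [this]
  exact innerTerm_neg_succ_eq_zero q (by omega)

/-! ### Exchanging the order of summation. -/

theorem hasSum_pairTerm_right {q : ℂ} (hq : ‖q‖ < 1) (n : ℕ) :
    HasSum (fun k => pairTerm q n k)
      (∑ m ∈ Finset.Icc (-(((n : ℤ) + 1) / 2)) ((n : ℤ) / 2), innerTerm q n m) := by
  rw [sum_innerTerm hq]
  refine hasSum_sum_of_ne_finset_zero fun k hk => ?_
  rw [Finset.mem_range] at hk
  rw [pairTerm, if_neg (by omega)]

theorem hasSum_pairTerm_left {q : ℂ} (hq : ‖q‖ < 1) (k : ℕ) :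
    HasSum (fun n => pairTerm q n k)
      (((-1) ^ k * (q ^ 12) ^ k * (q ^ 13) ^ k.choose 2 +
        (-1) ^ (k + 1) * q ^ (k + 1) * (q ^ 13) ^ (k + 1).choose 2) *
          (qPochhammerInf q q)⁻¹) := by
  have hz : ∑ n ∈ Finset.range (2 * k), pairTerm q n k = 0 :=
    Finset.sum_eq_zero fun n hn => by
      rw [Finset.mem_range] at hn
      rw [pairTerm, if_neg (by omega)]
  -- The terms with `n < 2k` vanish, so the sum may start at `n = 2k`.
  rw [← add_zero (_ * _), ← hz, ← hasSum_nat_add_iff]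
  have hc := two_mul_choose_two_add k
  have hc' : (k + 1).choose 2 = k + k.choose 2 := by
    rw [Nat.choose_succ_succ' k 1, Nat.choose_one_right]
  have p1 : (q ^ 12) ^ k * (q ^ 13) ^ k.choose 2 =
      q ^ ((k + 1).choose 2 + (2 * k ^ 2 + k) + (4 * k ^ 2 + 4 * k)) := by
    rw [← pow_mul, ← pow_mul, ← pow_add]
    congr 1
    linarith
  have p2 : q ^ (k + 1) * (q ^ 13) ^ (k + 1).choose 2 =
      q ^ ((k + 1).choose 2 + (2 * k ^ 2 + k) + (4 * k ^ 2 + 4 * k)) * q ^ (2 * k + 1) := by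
    rw [← pow_mul, ← pow_add, ← pow_add]
    congr 1
    linarith
  have hval : (-1) ^ k * (q ^ 12) ^ k * (q ^ 13) ^ k.choose 2 +
      (-1) ^ (k + 1) * q ^ (k + 1) * (q ^ 13) ^ (k + 1).choose 2 =
      (-1) ^ k * q ^ ((k + 1).choose 2 + (2 * k ^ 2 + k) + (4 * k ^ 2 + 4 * k)) *
        (1 - q ^ (2 * k + 1)) := by
    linear_combination (-1) ^ k * p1 - (-1) ^ k * p2
  rw [hval]
  refine ((hasSum_durfeeTerm hq (4 * k + 2)).mul_left _).congr_fun fun j => ?_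
  rw [pairTerm, if_pos (by omega), durfeeTerm, Nat.add_sub_cancel,
    show j + 2 * k + 2 * k + 2 = j + (4 * k + 2) by ring,
    show (k + 1).choose 2 + (2 * k ^ 2 + k) + ((j + 2 * k) ^ 2 + 2 * (j + 2 * k)) =
      (k + 1).choose 2 + (2 * k ^ 2 + k) + (4 * k ^ 2 + 4 * k) + (j ^ 2 + j * (4 * k + 2)) by ring,
    pow_add q _ (j ^ 2 + _)]
  ring

/-- Domination by a multiple of `‖q‖^n ‖q‖^k`; this licenses the exchange of the two sums. -/
theorem summable_pairTerm {q : ℂ} (hq : ‖q‖ < 1) :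
    Summable fun x : ℕ × ℕ => pairTerm q x.1 x.2 := by
  obtain ⟨C, hC0, hC⟩ := exists_bound_inv_qPochhammer_self hq
  have hg := summable_geometric_of_lt_one (norm_nonneg q) hq
  refine .of_norm_bounded ((hg.mul_of_nonneg hg (fun _ => by positivity)
    fun _ => by positivity).mul_right (2 * (C * C))) fun ⟨n, k⟩ => ?_
  simp only [pairTerm]
  split_ifs
  · have := norm_one_sub_pow_le hq (2 * k + 1)
    simp only [norm_mul, norm_pow (-1 : ℂ), norm_neg, norm_one, one_pow, one_mul, mul_assoc]
    rw [← mul_assoc (‖q‖ ^ n), ← pow_add]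
    gcongr
    · exact norm_pow_le_norm_pow hq (by nlinarith)
    · exact hC _
    · exact hC _
  · rw [norm_zero]
    positivity

theorem mainTheorem1 (q : ℂ) (hq : ‖q‖ < 1) :
    HasSum
      (fun n : ℕ =>
        ∑ m ∈ Finset.Icc (-(((n : ℤ) + 1) / 2)) ((n : ℤ) / 2),
          (-1 : ℂ) ^ m * q ^ ((n : ℤ) * ((n : ℤ) + 2) + m * (5 * m + 3) / 2) /
            ((1 + q ^ (n + 1)) * qPochhammer q q (2 * n + 1)) *
            qBinomial q (2 * n + 1) ((n : ℤ) - 2 * m))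
      (qPochhammerInf q (q ^ 13) * qPochhammerInf (q ^ 12) (q ^ 13) *
          qPochhammerInf (q ^ 13) (q ^ 13) /
        qPochhammerInf q q) := by
  have hpow : ∀ n : ℕ, ‖q ^ (n + 1)‖ < 1 := fun n => by
    rw [norm_pow]; exact pow_lt_one₀ (norm_nonneg q) hq n.succ_ne_zero
  have hs := summable_pairTerm hq
  have hleft := ((Equiv.prodComm ℕ ℕ).hasSum_iff.mpr hs.hasSum).prod_fiberwise
    (hasSum_pairTerm_left hq)
  have hjtp := (hasSum_jacobi_triple_product (hpow 12) (hpow 11) hq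
    (show q ^ 12 * q = q ^ 13 by ring)).mul_right (qPochhammerInf q q)⁻¹
  have hright := hs.hasSum.prod_fiberwise (hasSum_pairTerm_right hq)
  rw [hleft.unique hjtp] at hright
  rw [div_eq_mul_inv, mul_comm (qPochhammerInf q (q ^ 13))]
  exact hright
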